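/- For each $n\in\mathbb{N}$ let $M_n,N_n$ be positive integers with $N_n\to\infty$ (the $M_n$ are otherwise arbitrary). Let $U_n\in\mathbb{R}^{N_n\times N_n}$ satisfy $U_n^TU_n=U_nU_n^T=N_nI$, with entries of magnitude $O(1)$, i.e. $|U_n(j,t)|\le C$ for a constant $C$ independent of $n,j,t$. Let $S_n$ be a random $M_n\times N_n$ matrix whose entries are independent and uniformly distributed on $\{-1,+1\}$, and put $$\Phi_n=\frac{1}{\sqrt{M_nN_n}}\,S_nU_n .$$ Then the entries of $\Phi_n$ are asymptotically Gaussian $\mathcal N(0,1/M_n)$, in the following sense. (i) For every choice of positions $(k_n,t_n)$ with $1\le k_n\le M_n$ and $1\le t_n\le N_n$, the random variables $\sqrt{M_n}\,\Phi_n(k_n,t_n)$ converge in distribution to $\mathcal N(0,1)$ as $n\to\infty$. (ii) The same holds jointly: for every fixed $d$ and every choice, for each $n$, of $d$ distinct positions $(k_n^{(1)},t_n^{(1)}),\dots,(k_n^{(d)},t_n^{(d)})$, the random vectors $\sqrt{M_n}\,\bigl(\Phi_n(k_n^{(i)},t_n^{(i)})\bigr)_{i=1}^d$ converge in distribution to the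 standard Gaussian vector $\mathcal N(0,I_d)$ as $n\to\infty$. -/

import Mathlib

open MeasureTheory ProbabilityTheory Filter
open scoped Matrix

noncomputable section

/-- The uniform distribution on the two signs `1` and `-1`. -/
def uniformSign : Measure ℝ :=
  (1 / 2 : ENNReal) • Measure.dirac 1 + (1 / 2 : ENNReal) • Measure.dirac (-1)

/-- The entries of the random matrix `S` are independent, each uniform on `{1, -1}`. -/
structure IsUniformSignMatrix {Ω : Type*} [MeasurableSpace Ω] {M N : ℕ}
    (S : Ω → Matrix (Fin M) (Fin N) ℝ) (P : Measure Ω) : Prop where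
  indep : iIndepFun (fun (q : Fin M × Fin N) (ω : Ω) => S ω q.1 q.2) P
  law : ∀ (k : Fin M) (j : Fin N), HasLaw (fun ω => S ω k j) uniformSign P

/-- A real `N × N` matrix that is unitary up to the normalisation `Uᵀ U = U Uᵀ = N I`. -/
structure IsScaledUnitary {N : ℕ} (U : Matrix (Fin N) (Fin N) ℝ) : Prop where
  transpose_mul_self : Uᵀ * U = (N : ℝ) • (1 : Matrix (Fin N) (Fin N) ℝ)
  mul_transpose_self : U * Uᵀ = (N : ℝ) • (1 : Matrix (Fin N) (Fin N) ℝ)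

/-- The sensing matrix `Φ = (1 / √(M N)) S U`. -/
def sensingMatrix {M N : ℕ} (S : Matrix (Fin M) (Fin N) ℝ) (U : Matrix (Fin N) (Fin N) ℝ) :
    Matrix (Fin M) (Fin N) ℝ :=
  (1 / Real.sqrt ((M : ℝ) * (N : ℝ))) • (S * U)

end

/-!
The proof is by characteristic functions. For a test vector `l : ℝᵈ`, the scalar product of `l` with
the vector of the `d` selected entries of `√M Φ` is a Rademacher sum `∑ q, a q * S q` over the
positions `q` of the matrix `S`, with deterministic coefficients `a = testCoeff U p l`. Since `S` has
independent uniform signs, the characteristic function at `l` is `∏ q, cos (a q)`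
(`IsUniformSignMatrix.charFun_entries`).

Two properties of the coefficients give the limit. As the selected positions are distinct and the
columns of `U` are orthogonal with squared norm `N`, the sum of the `a q ^ 2` is exactly `‖l‖ ^ 2`
(`sum_testCoeff_sq`). As the entries of `U` are bounded, every `a q` is `O(1 / √N)`
(`abs_testCoeff_le`). Because `cos x = exp (-x ^ 2 / 2) + O(x ^ 4)`, replacing each cosine by the
corresponding exponential changes the product by at most
`2 ∑ a q ^ 4 ≤ 2 (max |a q|) ^ 2 ∑ a q ^ 2 → 0`
(`abs_prod_cos_sub_exp_le`), so the characteristic functions converge to `exp (-‖l‖ ^ 2 / 2)`, and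
Lévy's convergence theorem applies. Convergence of a single entry is the case `d = 1`.
-/

/-! ### Products of cosines -/

/-- Telescoping bound for the difference of two products with factors in `[-1, 1]`. -/
lemma abs_prod_sub_prod_le {ι : Type*} (s : Finset ι) (f g : ι → ℝ)
    (hf : ∀ i, |f i| ≤ 1) (hg : ∀ i, |g i| ≤ 1) :
    |∏ i ∈ s, f i - ∏ i ∈ s, g i| ≤ ∑ i ∈ s, |f i - g i| := by
  classical
  induction s using Finset.induction with
  | empty => simp
  | insert i s hi ih =>
    rw [Finset.prod_insert hi, Finset.prod_insert hi, Finset.sum_insert hi]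
    have hprod : |∏ j ∈ s, g j| ≤ 1 := by
      rw [Finset.abs_prod]
      exact Finset.prod_le_one (fun j _ => abs_nonneg _) fun j _ => hg j
    calc |f i * ∏ j ∈ s, f j - g i * ∏ j ∈ s, g j|
        = |(f i - g i) * ∏ j ∈ s, g j + f i * (∏ j ∈ s, f j - ∏ j ∈ s, g j)| := by ring_nf
      _ ≤ |f i - g i| * |∏ j ∈ s, g j| + |f i| * |∏ j ∈ s, f j - ∏ j ∈ s, g j| := by
        rw [← abs_mul, ← abs_mul]
        exact abs_add_le _ _
      _ ≤ |f i - g i| * 1 + 1 * ∑ j ∈ s, |f j - g j| := by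
        gcongr
        exact hf i
      _ = _ := by ring

lemma abs_cos_sub_exp_le (x : ℝ) : |Real.cos x - Real.exp (-(x ^ 2 / 2))| ≤ 2 * x ^ 4 := by
  rcases le_total |x| 1 with hx | hx
  · have hcos := Real.cos_bound hx
    have hx2 : x ^ 2 ≤ 1 := (sq_le_one_iff_abs_le_one x).2 hx
    have hexp := Real.abs_exp_sub_one_sub_id_le (x := -(x ^ 2 / 2))
      (by rw [abs_neg, abs_of_nonneg (by positivity)]; linarith)
    have h4 : |x| ^ 4 = x ^ 4 := Even.pow_abs (by decide) x
    have h4' : 0 ≤ x ^ 4 := by positivity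
    rw [h4] at hcos
    rw [abs_le] at *
    constructor <;> nlinarith [hcos.1, hcos.2, hexp.1, hexp.2]
  -- For `|x| ≥ 1` the bound is trivial, as both functions take values in `[-1, 1]`.
  · have h4 : 1 ≤ x ^ 4 := by
      rw [← Even.pow_abs (by decide : Even 4) x]
      exact one_le_pow₀ hx
    have hexp : Real.exp (-(x ^ 2 / 2)) ≤ 1 := Real.exp_le_one_iff.2 (by nlinarith [sq_nonneg x])
    have hexp' := Real.exp_pos (-(x ^ 2 / 2))
    have := Real.cos_le_one x
    have := Real.neg_one_le_cos x
    rw [abs_le]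
    constructor <;> linarith

lemma abs_prod_cos_sub_exp_le {ι : Type*} [Fintype ι] (a : ι → ℝ) {B v : ℝ}
    (hB : ∀ i, |a i| ≤ B) (hv : ∑ i, a i ^ 2 = v) :
    |∏ i, Real.cos (a i) - Real.exp (-(v / 2))| ≤ 2 * B ^ 2 * v := by
  have hexp : Real.exp (-(v / 2)) = ∏ i, Real.exp (-(a i ^ 2 / 2)) := by
    rw [← Real.exp_sum, Finset.sum_neg_distrib, ← Finset.sum_div, hv]
  calc |∏ i, Real.cos (a i) - Real.exp (-(v / 2))|
      ≤ ∑ i, |Real.cos (a i) - Real.exp (-(a i ^ 2 / 2))| := by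
        rw [hexp]
        refine abs_prod_sub_prod_le _ _ _ (fun i => Real.abs_cos_le_one _) fun i => ?_
        rw [Real.abs_exp, Real.exp_le_one_iff]
        nlinarith [sq_nonneg (a i)]
    _ ≤ ∑ i, 2 * B ^ 2 * a i ^ 2 := by
        refine Finset.sum_le_sum fun i _ => (abs_cos_sub_exp_le _).trans ?_
        have : a i ^ 2 ≤ B ^ 2 := sq_le_sq' (abs_le.1 (hB i)).1 (abs_le.1 (hB i)).2
        nlinarith [sq_nonneg (a i)]
    _ = 2 * B ^ 2 * v := by rw [← Finset.mul_sum, hv]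

/-! ### Rademacher sums -/

lemma charFun_uniformSign (t : ℝ) : charFun uniformSign t = (Real.cos t : ℂ) := by
  have hint (x : ℝ) :
      Integrable (fun y : ℝ => Complex.exp (t * y * Complex.I)) (Measure.dirac x) :=
    integrable_dirac (by simp)
  rw [charFun_apply_real, uniformSign,
    integral_add_measure ((hint 1).smul_measure (by simp)) ((hint (-1)).smul_measure (by simp)),
    integral_smul_measure, integral_smul_measure, integral_dirac, integral_dirac,
    Complex.ofReal_cos, Complex.cos]
  simp
  ring

/-- Evaluating at `1` suffices, since the frequency can be absorbed into the coefficients `a`. -/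
lemma charFun_map_sum_mul_sign {Ω ι : Type*} [MeasurableSpace Ω] [Fintype ι] {P : Measure Ω}
    {X : ι → Ω → ℝ} (hind : iIndepFun X P) (hlaw : ∀ i, HasLaw (X i) uniformSign P)
    (a : ι → ℝ) :
    charFun (P.map fun ω => ∑ i, a i * X i ω) 1 = ((∏ i, Real.cos (a i) : ℝ) : ℂ) := by
  have := hind.isProbabilityMeasure
  rw [iIndepFun.charFun_map_fun_sum_eq_prod (X := fun i ω => a i * X i ω)
    (fun i => (hlaw i).aemeasurable.const_mul _)
    (hind.comp (fun i x => a i * x) fun i => by fun_prop), Finset.prod_apply]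
  push_cast
  refine Finset.prod_congr rfl fun i _ => ?_
  rw [charFun_map_mul_comp (hlaw i).aemeasurable, (hlaw i).map_eq, charFun_uniformSign, mul_one,
    Complex.ofReal_cos]

/-! ### Linear combinations of entries of the sensing matrix -/

/-- The coefficient of the sign `S q.1 q.2` in the linear combination, with weights `l`, of the
entries of `√M Φ` at the positions `p`. -/
noncomputable def testCoeff {M N d : ℕ} (U : Matrix (Fin N) (Fin N) ℝ) (p : Fin d → Fin M × Fin N)
    (l : Fin d → ℝ) (q : Fin M × Fin N) : ℝ :=
  ∑ i, l i * ((if (p i).1 = q.1 then U q.2 (p i).2 else 0) / Real.sqrt N)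

lemma sqrt_mul_sensingMatrix_apply {M N : ℕ} (S : Matrix (Fin M) (Fin N) ℝ)
    (U : Matrix (Fin N) (Fin N) ℝ) (k : Fin M) (t : Fin N) :
    Real.sqrt M * sensingMatrix S U k t = ∑ j, S k j * (U j t / Real.sqrt N) := by
  have hM : Real.sqrt (M : ℝ) ≠ 0 :=
    (Real.sqrt_pos.2 (Nat.cast_pos.2 k.pos)).ne'
  rw [sensingMatrix, Matrix.smul_apply, Matrix.mul_apply, Real.sqrt_mul (Nat.cast_nonneg M),
    smul_eq_mul, ← mul_assoc, one_div, mul_inv, ← mul_assoc, mul_inv_cancel₀ hM, one_mul,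
    Finset.mul_sum]
  refine Finset.sum_congr rfl fun j _ => ?_
  ring

lemma sum_mul_entries_eq {M N d : ℕ} (S : Matrix (Fin M) (Fin N) ℝ)
    (U : Matrix (Fin N) (Fin N) ℝ) (p : Fin d → Fin M × Fin N) (l : Fin d → ℝ) :
    ∑ i, l i * (Real.sqrt M * sensingMatrix S U (p i).1 (p i).2) =
      ∑ q, testCoeff U p l q * S q.1 q.2 := by
  simp_rw [testCoeff, Finset.sum_mul]
  rw [Finset.sum_comm]
  refine Finset.sum_congr rfl fun i _ => ?_
  rw [sqrt_mul_sensingMatrix_apply, Fintype.sum_prod_type, Finset.sum_eq_single (p i).1]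
  · rw [Finset.mul_sum]
    refine Finset.sum_congr rfl fun j _ => ?_
    simp only [if_true]
    ring
  · intro k _ hk
    simp [hk.symm]
  · simp

/-- Distinct positions carry orthonormal coefficient vectors: those in different rows of `S` have
disjoint supports, and those in the same row are distinct columns of `U / √N`. -/
lemma sum_testCoeff_sq {M N d : ℕ} {U : Matrix (Fin N) (Fin N) ℝ} (hU : IsScaledUnitary U)
    {p : Fin d → Fin M × Fin N} (hp : Function.Injective p) (l : Fin d → ℝ) :
    ∑ q, testCoeff U p l q ^ 2 = ∑ i, l i ^ 2 := by
  have hcol (s t : Fin N) : ∑ j, U j s * U j t = if s = t then (N : ℝ) else 0 := by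
    have h := congrFun (congrFun hU.transpose_mul_self s) t
    simpa [Matrix.mul_apply, Matrix.one_apply] using h
  have horth (i j : Fin d) :
      ∑ q : Fin M × Fin N,
        ((if (p i).1 = q.1 then U q.2 (p i).2 else 0) / Real.sqrt N) *
          ((if (p j).1 = q.1 then U q.2 (p j).2 else 0) / Real.sqrt N) =
        if i = j then 1 else 0 := by
    have hN : (N : ℝ) ≠ 0 := Nat.cast_ne_zero.2 (p i).2.pos.ne'
    rw [Fintype.sum_prod_type, Finset.sum_eq_single (p i).1]
    · by_cases hk : (p j).1 = (p i).1
      · simp only [hk, if_true, div_mul_div_comm, Real.mul_self_sqrt (Nat.cast_nonneg N),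
          ← Finset.sum_div, hcol]
        have hij : (p i).2 = (p j).2 ↔ i = j :=
          ⟨fun h => hp (Prod.ext hk.symm h), fun h => h ▸ rfl⟩
        simp only [hij]
        split_ifs <;> simp [hN]
      · have hij : i ≠ j := fun h => hk (h ▸ rfl)
        simp [hk, hij]
    · intro k _ hk
      simp [hk.symm]
    · simp
  calc ∑ q, testCoeff U p l q ^ 2
      = ∑ i, ∑ j, l i * l j * ∑ q : Fin M × Fin N,
        ((if (p i).1 = q.1 then U q.2 (p i).2 else 0) / Real.sqrt N) *
          ((if (p j).1 = q.1 then U q.2 (p j).2 else 0) / Real.sqrt N) := by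
        simp_rw [testCoeff, sq, Finset.sum_mul_sum, Finset.mul_sum]
        rw [Finset.sum_comm]
        refine Finset.sum_congr rfl fun i _ => ?_
        rw [Finset.sum_comm]
        refine Finset.sum_congr rfl fun j _ => Finset.sum_congr rfl fun q _ => ?_
        ring
    _ = ∑ i, l i ^ 2 := by
        simp [horth, sq]

lemma abs_testCoeff_le {M N d : ℕ} {U : Matrix (Fin N) (Fin N) ℝ} {C : ℝ}
    (hC : ∀ j t, |U j t| ≤ C) (p : Fin d → Fin M × Fin N) (l : Fin d → ℝ) (q : Fin M × Fin N) :
    |testCoeff U p l q| ≤ (∑ i, |l i|) * C / Real.sqrt N := by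
  have hC0 : 0 ≤ C := (abs_nonneg _).trans (hC q.2 q.2)
  rw [testCoeff, mul_div_assoc, Finset.sum_mul]
  refine (Finset.abs_sum_le_sum_abs _ _).trans (Finset.sum_le_sum fun i _ => ?_)
  rw [abs_mul, abs_div, abs_of_nonneg (Real.sqrt_nonneg _)]
  gcongr
  split_ifs
  · exact hC _ _
  · simpa using hC0

/-! ### Convergence of the characteristic functions -/

lemma IsUniformSignMatrix.aemeasurable_entry {Ω : Type*} [MeasurableSpace Ω] {M N : ℕ}
    {S : Ω → Matrix (Fin M) (Fin N) ℝ} {P : Measure Ω} (hS : IsUniformSignMatrix S P)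
    (U : Matrix (Fin N) (Fin N) ℝ) (k : Fin M) (t : Fin N) :
    AEMeasurable (fun ω => Real.sqrt M * sensingMatrix (S ω) U k t) P := by
  simp_rw [sqrt_mul_sensingMatrix_apply]
  exact Finset.aemeasurable_fun_sum _ fun j _ => (hS.law k j).aemeasurable.mul_const _

lemma IsUniformSignMatrix.aemeasurable_entries {Ω : Type*} [MeasurableSpace Ω] {M N d : ℕ}
    {S : Ω → Matrix (Fin M) (Fin N) ℝ} {P : Measure Ω} (hS : IsUniformSignMatrix S P)
    (U : Matrix (Fin N) (Fin N) ℝ) (p : Fin d → Fin M × Fin N) :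
    AEMeasurable (fun ω => WithLp.toLp 2 (fun i : Fin d =>
      Real.sqrt M * sensingMatrix (S ω) U (p i).1 (p i).2)) P :=
  (WithLp.measurable_toLp 2 (Fin d → ℝ)).comp_aemeasurable
    (aemeasurable_pi_lambda _ fun i => hS.aemeasurable_entry U (p i).1 (p i).2)

lemma IsUniformSignMatrix.charFun_entries {Ω : Type*} [MeasurableSpace Ω] {M N d : ℕ}
    {S : Ω → Matrix (Fin M) (Fin N) ℝ} {P : Measure Ω} (hS : IsUniformSignMatrix S P)
    (U : Matrix (Fin N) (Fin N) ℝ) (p : Fin d → Fin M × Fin N) (l : EuclideanSpace ℝ (Fin d)) :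
    charFun (P.map fun ω => WithLp.toLp 2 (fun i : Fin d =>
      Real.sqrt M * sensingMatrix (S ω) U (p i).1 (p i).2)) l =
      ((∏ q, Real.cos (testCoeff U p l q) : ℝ) : ℂ) := by
  have hsum : AEMeasurable (fun ω => ∑ q, testCoeff U p l q * S ω q.1 q.2) P :=
    Finset.aemeasurable_fun_sum _ fun q _ => (hS.law q.1 q.2).aemeasurable.const_mul _
  rw [← charFun_map_sum_mul_sign hS.indep (fun q => hS.law q.1 q.2) (testCoeff U p l),
    charFun_apply, charFun_apply_real, integral_map (hS.aemeasurable_entries U p) (by fun_prop),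
    integral_map hsum (by fun_prop)]
  refine integral_congr_ae (ae_of_all _ fun ω => ?_)
  simp only [← sum_mul_entries_eq, PiLp.inner_apply]
  simp

lemma tendsto_prod_cos_testCoeff {M N : ℕ → ℕ} (hN : Tendsto N atTop atTop)
    {U : (n : ℕ) → Matrix (Fin (N n)) (Fin (N n)) ℝ} (hU : ∀ n, IsScaledUnitary (U n))
    {C : ℝ} (hC : ∀ (n : ℕ) (j t : Fin (N n)), |U n j t| ≤ C) {d : ℕ}
    {p : (n : ℕ) → Fin d → Fin (M n) × Fin (N n)} (hp : ∀ n, Function.Injective (p n))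
    (l : Fin d → ℝ) :
    Tendsto (fun n => ∏ q, Real.cos (testCoeff (U n) (p n) l q)) atTop
      (nhds (Real.exp (-((∑ i, l i ^ 2) / 2)))) := by
  have hsqrt : Tendsto (fun n => Real.sqrt (N n : ℝ)) atTop atTop :=
    Real.tendsto_sqrt_atTop.comp (tendsto_natCast_atTop_atTop.comp hN)
  have hB : Tendsto
      (fun n => 2 * ((∑ i, |l i|) * C / Real.sqrt (N n)) ^ 2 * ∑ i, l i ^ 2) atTop (nhds 0) := by
    simpa using (((hsqrt.const_div_atTop ((∑ i, |l i|) * C)).pow 2).const_mul 2).mul_const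
      (∑ i, l i ^ 2)
  rw [tendsto_iff_norm_sub_tendsto_zero]
  refine squeeze_zero (fun n => norm_nonneg _) (fun n => ?_) hB
  exact abs_prod_cos_sub_exp_le _ (abs_testCoeff_le (hC n) (p n) l)
    (sum_testCoeff_sq (hU n) (hp n) l)

/-! ### Convergence in distribution -/

theorem tendstoInDistribution_entries
    {M N : ℕ → ℕ} (hN : Tendsto N atTop atTop)
    {U : (n : ℕ) → Matrix (Fin (N n)) (Fin (N n)) ℝ} (hU : ∀ n, IsScaledUnitary (U n))
    {C : ℝ} (hC : ∀ (n : ℕ) (j t : Fin (N n)), |U n j t| ≤ C)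
    {Ω : ℕ → Type*} [∀ n, MeasurableSpace (Ω n)]
    {P : (n : ℕ) → Measure (Ω n)} [∀ n, IsProbabilityMeasure (P n)]
    {S : (n : ℕ) → Ω n → Matrix (Fin (M n)) (Fin (N n)) ℝ}
    (hS : ∀ n, IsUniformSignMatrix (S n) (P n)) {d : ℕ}
    {p : (n : ℕ) → Fin d → Fin (M n) × Fin (N n)} (hp : ∀ n, Function.Injective (p n)) :
    TendstoInDistribution
      (fun (n : ℕ) (ω : Ω n) => WithLp.toLp 2 (fun i : Fin d =>
        Real.sqrt (M n : ℝ) * sensingMatrix (S n ω) (U n) (p n i).1 (p n i).2))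
      atTop (id : EuclideanSpace ℝ (Fin d) → EuclideanSpace ℝ (Fin d)) P
      (stdGaussian (EuclideanSpace ℝ (Fin d))) where
  forall_aemeasurable n := (hS n).aemeasurable_entries (U n) (p n)
  tendsto := by
    refine ProbabilityMeasure.tendsto_iff_tendsto_charFun.2 fun l => ?_
    simp only [ProbabilityMeasure.coe_mk, Measure.map_id, charFun_stdGaussian,
      (hS _).charFun_entries]
    have hlim := (Complex.continuous_ofReal.tendsto _).comp
      (tendsto_prod_cos_testCoeff hN hU hC hp l)
    rw [← EuclideanSpace.real_norm_sq_eq] at hlim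
    convert! hlim using 2
    push_cast
    rw [neg_div]

lemma map_apply_stdGaussian {d : ℕ} (i : Fin d) :
    (stdGaussian (EuclideanSpace ℝ (Fin d))).map (fun x => x i) = gaussianReal 0 1 := by
  rw [← map_pi_eq_stdGaussian, Measure.map_map (by fun_prop) (by fun_prop)]
  exact (measurePreserving_eval (fun _ : Fin d => gaussianReal 0 1) i).map_eq

theorem mainTheorem2
    (M N : ℕ → ℕ) (hN : Tendsto N atTop atTop)
    (U : (n : ℕ) → Matrix (Fin (N n)) (Fin (N n)) ℝ)
    (hU : ∀ n, IsScaledUnitary (U n))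
    (hUbdd : ∃ C : ℝ, ∀ (n : ℕ) (j t : Fin (N n)), |U n j t| ≤ C)
    {Ω : ℕ → Type*} [∀ n, MeasurableSpace (Ω n)]
    (P : (n : ℕ) → Measure (Ω n)) [∀ n, IsProbabilityMeasure (P n)]
    (S : (n : ℕ) → Ω n → Matrix (Fin (M n)) (Fin (N n)) ℝ)
    (hS : ∀ n, IsUniformSignMatrix (S n) (P n)) :
    (∀ (k : (n : ℕ) → Fin (M n)) (t : (n : ℕ) → Fin (N n)),
      TendstoInDistribution
        (fun (n : ℕ) (ω : Ω n) =>
          Real.sqrt (M n : ℝ) * sensingMatrix (S n ω) (U n) (k n) (t n))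
        atTop (id : ℝ → ℝ) P (gaussianReal 0 1)) ∧
    (∀ (d : ℕ) (p : (n : ℕ) → Fin d → Fin (M n) × Fin (N n)),
      (∀ n, Function.Injective (p n)) →
      TendstoInDistribution
        (fun (n : ℕ) (ω : Ω n) => WithLp.toLp 2 (fun i : Fin d =>
          Real.sqrt (M n : ℝ) * sensingMatrix (S n ω) (U n) (p n i).1 (p n i).2))
        atTop (id : EuclideanSpace ℝ (Fin d) → EuclideanSpace ℝ (Fin d)) P
        (stdGaussian (EuclideanSpace ℝ (Fin d)))) := by
  obtain ⟨C, hC⟩ := hUbdd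
  refine ⟨fun k t => ?_, fun d p hp => tendstoInDistribution_entries hN hU hC hS hp⟩
  have hvec := tendstoInDistribution_entries hN hU hC hS (d := 1)
    (p := fun n _ => (k n, t n)) fun n => Function.injective_of_subsingleton _
  have hcoord := hvec.continuous_comp (g := fun x : EuclideanSpace ℝ (Fin 1) => x 0)
    (by fun_prop)
  refine ⟨fun n => hcoord.forall_aemeasurable n, aemeasurable_id, ?_⟩
  convert! hcoord.tendsto using 3
  refine congrArg nhds (Subtype.ext ?_)
  change Measure.map id (gaussianReal 0 1) =
    (stdGaussian (EuclideanSpace ℝ (Fin 1))).map (fun x => x 0)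
  rw [Measure.map_id, map_apply_stdGaussian]
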